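/- Let $F$ be a perfect field and let $k/F$ be an arbitrary field extension. Then: (1) $k/F$ is separable, in the sense that every intermediate field $F\subseteq K'\subseteq k$ that is finitely generated as a field extension of $F$ has a separating transcendence basis over $F$, i.e. a finite transcendence basis $\{x_1,\dots,x_n\}\subseteq K'$ of $K'/F$ such that $K'$ is a separable algebraic extension of $F(x_1,\dots,x_n)$; (2) $k$ is formally smooth over $F$, i.e. for every $F$-algebra $A$ (commutative) and every ideal $I\subseteq A$ with $I^2=0$, each $F$-algebra homomorphism $k\to A/I$ lifts to an $F$-algebra homomorphism $k\to A$. -/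

import Mathlib

/-- `K/k` has a separating transcendence basis: a finite transcendence basis `s` such that `K` is
a separable algebraic extension of `k(s)`. -/
def HasSeparatingTranscendenceBasis (k K : Type*) [Field k] [Field K] [Algebra k K] : Prop :=
  ∃ s : Finset K, IsTranscendenceBasis k ((↑) : s → K) ∧
    Algebra.IsSeparable (IntermediateField.adjoin k (s : Set K)) K

/-- An arbitrary (not necessarily algebraic) field extension `K/k` is separable if every
subextension that is finitely generated as a field extension of `k` has a separating
transcendence basis. -/
def IsSeparableFieldExtension (k K : Type*) [Field k] [Field K] [Algebra k K] : Prop :=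
  ∀ K' : IntermediateField k K, K'.FG → HasSeparatingTranscendenceBasis k K'

/-!
Separable extensions of any field are formally smooth. A separably generated extension `K/F` is
formally étale over a purely transcendental one, hence formally smooth. For a general separable
`k/F` the module `Ω[k⁄F]` is projective because `k` is a field, so the only obstruction to formal
smoothness is `H¹(L_{k/F})`. If `I` is the kernel of a polynomial presentation of `k`, a class in it
is represented by an element of `I` whose partial derivatives lie in `I`, and it is zero when this
polynomial lies in `I²`. The polynomial involves only finitely many elements of `k`, so the class
comes from a finitely generated subextension, where it vanishes. Over a perfect field every finitely
generated extension is separably generated.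
-/

section H1Cotangent

open MvPolynomial

variable {R A : Type*} [CommRing R] [CommRing A] [Algebra R A]

theorem cotangentComplex_mk_eq_zero_iff {ι : Type*} (P : Algebra.Generators R A ι)
    (p : P.toExtension.ker) :
    P.toExtension.cotangentComplex (.mk p) = 0 ↔ ∀ i, pderiv i p.1 ∈ P.ker := by
  rw [← P.cotangentSpaceBasis.repr.map_eq_zero_iff, Finsupp.ext_iff]
  refine forall_congr' fun i ↦ ?_
  rw [Algebra.Extension.cotangentComplex_mk, P.ker_eq_ker_aeval_val]
  exact Eq.congr_left (P.cotangentSpaceBasis_repr_one_tmul p i)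

theorem subsingleton_h1Cotangent_iff_forall_mem_ker_sq {ι : Type*} (P : Algebra.Generators R A ι) :
    Subsingleton (Algebra.H1Cotangent R A) ↔
      ∀ p ∈ P.ker, (∀ i, pderiv i p ∈ P.ker) → p ∈ P.ker ^ 2 := by
  have mk_eq_zero_iff (p : P.toExtension.ker) :
      Algebra.Extension.Cotangent.mk p = 0 ↔ p.1 ∈ P.ker ^ 2 :=
    Algebra.Extension.Cotangent.ext_iff.trans (Ideal.toCotangent_eq_zero _ p)
  rw [← P.equivH1Cotangent.toEquiv.subsingleton_congr,
    Algebra.Extension.subsingleton_h1Cotangent, injective_iff_map_eq_zero,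
    Algebra.Extension.Cotangent.mk_surjective.forall]
  simp only [cotangentComplex_mk_eq_zero_iff, mk_eq_zero_iff]
  exact Subtype.forall

theorem rename_mem_ker_iff {B ι κ : Type*} [CommRing B] [Algebra R B]
    (P : Algebra.Generators R B ι) (Q : Algebra.Generators R A κ) {φ : B →ₐ[R] A}
    (hφ : Function.Injective φ) {f : ι → κ} (hf : Q.val ∘ f = φ ∘ P.val) {p : MvPolynomial ι R} :
    rename f p ∈ Q.ker ↔ p ∈ P.ker := by
  have aeval_rename_eq : aeval Q.val (rename f p) = φ (aeval P.val p) := by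
    rw [aeval_rename, hf]
    exact (comp_aeval_apply _ φ p).symm
  rw [Q.ker_eq_ker_aeval_val, P.ker_eq_ker_aeval_val, RingHom.mem_ker, RingHom.mem_ker,
    aeval_rename_eq, map_eq_zero_iff φ hφ]

theorem subsingleton_h1Cotangent_of_forall_finset_subset_subalgebra
    (h : ∀ s : Finset A, ∃ B : Subalgebra R A, (s : Set A) ⊆ B ∧
      Subsingleton (Algebra.H1Cotangent R B)) :
    Subsingleton (Algebra.H1Cotangent R A) := by
  let Q := Algebra.Generators.self R A
  refine (subsingleton_h1Cotangent_iff_forall_mem_ker_sq Q).mpr fun p hp hdp ↦ ?_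
  obtain ⟨B, hpB, hB⟩ := h p.vars
  let P := Algebra.Generators.self R B
  have hinj : Function.Injective B.val := Subtype.val_injective
  have rename_mem_iff (f : MvPolynomial B R) : rename B.val f ∈ Q.ker ↔ f ∈ P.ker :=
    rename_mem_ker_iff P Q hinj rfl
  obtain ⟨q, rfl⟩ := exists_rename_eq_of_vars_subset_range p B.val hinj (by simpa using hpB)
  have hdq (b : B) : pderiv b q ∈ P.ker := by
    rw [← rename_mem_iff, ← pderiv_rename hinj]
    exact hdp b
  have hq : q ∈ P.ker ^ 2 :=
    (subsingleton_h1Cotangent_iff_forall_mem_ker_sq P).mp hB q ((rename_mem_iff q).mp hp) hdq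
  have hker : P.ker ≤ Q.ker.comap (rename B.val) := fun f hf ↦ (rename_mem_iff f).mpr hf
  exact Ideal.le_comap_pow _ 2 (Ideal.pow_right_mono hker 2 hq)

end H1Cotangent

section FieldExtension

variable {F k : Type*} [Field F] [Field k] [Algebra F k]

theorem HasSeparatingTranscendenceBasis.formallySmooth
    (h : HasSeparatingTranscendenceBasis F k) : Algebra.FormallySmooth F k := by
  obtain ⟨s, hs, hsep⟩ := h
  rw [← Subtype.range_coe (s := (s : Set k))] at hsep
  exact .of_algebraicIndependent_of_isSeparable hs.1

theorem IsSeparableFieldExtension.formallySmooth (h : IsSeparableFieldExtension F k) :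
    Algebra.FormallySmooth F k := by
  refine ⟨inferInstance, subsingleton_h1Cotangent_of_forall_finset_subset_subalgebra fun s ↦ ?_⟩
  let E := IntermediateField.adjoin F (s : Set k)
  have : Algebra.FormallySmooth F E := (h E ⟨s, rfl⟩).formallySmooth
  exact ⟨E.toSubalgebra, IntermediateField.subset_adjoin F _, this.subsingleton_h1Cotangent⟩

theorem IsSeparableFieldExtension.of_perfectField [PerfectField F] :
    IsSeparableFieldExtension F k := fun E hE ↦
  have := IntermediateField.essFiniteType_iff.mpr hE
  exists_isTranscendenceBasis_and_isSeparable_of_perfectField F E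

end FieldExtension

theorem mainTheorem5 {F k : Type*} [Field F] [PerfectField F] [Field k] [Algebra F k] :
    IsSeparableFieldExtension F k ∧ Algebra.FormallySmooth F k :=
  ⟨.of_perfectField, IsSeparableFieldExtension.of_perfectField.formallySmooth⟩
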